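/- **Conventions.** An *Orlicz function* is a convex function $N:[0,\infty)\to[0,\infty)$ with $N(0)=0$ and $N(t)>0$ for $t>0$; $N'$ denotes its right derivative, and $N$ is called *normalized* if $\int_0^\infty x\,dN'(x)=1$ (Lebesgue–Stieltjes integral). For $N:[0,\infty)\to[0,\infty)$ and $x\in\mathbb R^n$ put $\|x\|_N=\inf\{t>0:\sum_{i=1}^n N(|x_i|/t)\le 1\}$. **Theorem 6.1 (generalization).** There are absolute constants $c_1,c_2>0$ such that the following holds. Let $N$ be a normalized Orlicz function that is almost everywhere twice differentiable on $(0,\infty)$, with $N''$ integrable on $(0,\infty)$ and $N'(0)=0$. Let $X$ be an integrable real random variable, and for $s\ge 0$ set $$M(s)=\int_{[0,\infty)} N(sx)\,d\mathbb P_{|X|}(x),$$ where $\mathbb P_{|X|}$ is the law of $|X|$. Then: 1. the integral defining $M(s)$ converges for every $s\ge 0$; 2. if $X$ is not almost surely zero, then $M$ is an Orlicz function; 3. if $X\neq 0$ almost surely, then $M$ is a normalized Orlicz function; 4. for every $n\in\mathbb N$, all independent copies $X_1,\dots,X_n$ of $X$, and every $a=(a_i)_{i=1}^n\in\mathbb R^n$,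 the random variable $\|(a_iX_i)_{i=1}^n\|_N$ is integrable and $$c_1\|a\|_M\le \mathbb E\,\|(a_iX_i)_{i=1}^n\|_N\le c_2\|a\|_M .$$ -/

import Mathlib

open Set Filter Topology MeasureTheory ProbabilityTheory

noncomputable section

/-- The right derivative of `f` at `x`. -/
def rightDeriv (f : ℝ → ℝ) (x : ℝ) : ℝ := derivWithin f (Ioi x) x

/-- Orlicz functions: convex functions on `[0, ∞)` that vanish at `0` and are positive on `(0, ∞)`.
They are represented by functions `ℝ → ℝ` of which only the values on `[0, ∞)` matter. -/
structure IsOrlicz (N : ℝ → ℝ) : Prop where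
  convexOn : ConvexOn ℝ (Ici 0) N
  map_zero : N 0 = 0
  pos : ∀ t, 0 < t → 0 < N t

namespace IsOrlicz

variable {N : ℝ → ℝ}

/-- An Orlicz function has a finite right derivative at every point of `[0, ∞)`. -/
theorem hasDerivWithinAt (h : IsOrlicz N) {x : ℝ} (hx : 0 ≤ x) :
    HasDerivWithinAt N (rightDeriv N x) (Ioi x) x := by
  rcases hx.eq_or_lt with rfl | hx
  · have hmono : MonotoneOn (slope N 0) (Ioo 0 1) :=
      (h.convexOn.monotoneOn_slope_gt (mem_Ici.2 le_rfl)).mono fun z hz => ⟨hz.1.le, hz.1⟩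
    have hbdd : BddBelow (slope N 0 '' Ioo 0 1) := by
      refine ⟨0, ?_⟩
      rintro _ ⟨z, hz, rfl⟩
      rw [slope_def_field, h.map_zero, sub_zero, sub_zero]
      exact (div_pos (h.pos z hz.1) hz.1).le
    have ht := hmono.tendsto_nhdsWithin_Ioo_right (by simp) hbdd
    have hd : HasDerivWithinAt N (sInf (slope N 0 '' Ioo 0 1)) (Ioi 0) 0 :=
      (hasDerivWithinAt_iff_tendsto_slope' self_notMem_Ioi).2 ht
    exact hd.differentiableWithinAt.hasDerivWithinAt
  · exact h.convexOn.hasDerivWithinAt_rightDeriv_of_mem_interior (by simpa using hx)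

theorem rightDeriv_le_slope (h : IsOrlicz N) {x y : ℝ} (hx : 0 ≤ x) (hxy : x < y) :
    rightDeriv N x ≤ slope N x y :=
  h.convexOn.le_slope_of_hasDerivWithinAt_Ioi hx (hx.trans hxy.le) hxy (h.hasDerivWithinAt hx)

theorem slope_le_rightDeriv (h : IsOrlicz N) {x y : ℝ} (hx : 0 ≤ x) (hxy : x < y) :
    slope N x y ≤ rightDeriv N y := by
  have hy : y ∈ interior (Ici (0 : ℝ)) := by simpa using hx.trans_lt hxy
  exact (h.convexOn.slope_le_leftDeriv_of_mem_interior hx hy hxy).trans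
    (h.convexOn.leftDeriv_le_rightDeriv_of_mem_interior hy)

theorem monotoneOn_rightDeriv (h : IsOrlicz N) : MonotoneOn (rightDeriv N) (Ici 0) := by
  intro x hx y _ hxy
  rcases hxy.eq_or_lt with rfl | hxy
  · exact le_rfl
  · exact (h.rightDeriv_le_slope hx hxy).trans (h.slope_le_rightDeriv hx hxy)

theorem rightDeriv_continuousWithinAt (h : IsOrlicz N) {x : ℝ} (hx : 0 ≤ x) :
    ContinuousWithinAt (rightDeriv N) (Ici x) x := by
  rw [← continuousWithinAt_Ioi_iff_Ici]
  refine tendsto_order.2 ⟨fun a ha => ?_, fun b hb => ?_⟩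
  · filter_upwards [self_mem_nhdsWithin] with y hy
    exact ha.trans_le (h.monotoneOn_rightDeriv hx (hx.trans (le_of_lt hy)) (le_of_lt hy))
  · have hd := h.hasDerivWithinAt hx
    have hs := (hasDerivWithinAt_iff_tendsto_slope' self_notMem_Ioi).1 hd
    obtain ⟨z, hzb, hxz⟩ :=
      ((hs.eventually (gt_mem_nhds hb)).and self_mem_nhdsWithin).exists
    have hxz : x < z := hxz
    have hc : Tendsto (fun y => slope N y z) (𝓝[>] x) (𝓝 (slope N x z)) := by
      simp only [slope_def_field]
      have h1 : Tendsto (fun y : ℝ => z - y) (𝓝[>] x) (𝓝 (z - x)) :=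
        ((continuous_const.sub continuous_id).tendsto x).mono_left nhdsWithin_le_nhds
      exact (tendsto_const_nhds.sub hd.continuousWithinAt.tendsto).div h1 (sub_pos.2 hxz).ne'
    filter_upwards [hc.eventually (gt_mem_nhds hzb), Ioo_mem_nhdsGT hxz] with y hy hyz
    exact (h.rightDeriv_le_slope (hx.trans hyz.1.le) hyz.2).trans_lt hy

/-- The right derivative `N'` of an Orlicz function as a nondecreasing right-continuous function,
extended to `(-∞, 0)` by the constant `N'(0)`; thus its Stieltjes measure `dN'` lives on `(0, ∞)`. -/
def derivStieltjes (h : IsOrlicz N) : StieltjesFunction ℝ where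
  toFun x := rightDeriv N (max x 0)
  mono' x y hxy := h.monotoneOn_rightDeriv (le_max_right x 0) (le_max_right y 0)
    (max_le_max_right 0 hxy)
  right_continuous' x := by
    have hc : ContinuousWithinAt (fun y : ℝ => max y 0) (Ici x) x :=
      (continuous_id.max continuous_const).continuousWithinAt
    have hd := h.rightDeriv_continuousWithinAt (le_max_right x 0)
    exact ContinuousWithinAt.comp (f := fun y : ℝ => max y 0) hd hc
      fun y (hy : x ≤ y) => max_le_max_right 0 hy

end IsOrlicz

/-- Normalized Orlicz functions: `∫_0^∞ x dN'(x) = 1`, with `N'` the right derivative. -/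
def IsNormalizedOrlicz (N : ℝ → ℝ) : Prop :=
  ∃ h : IsOrlicz N, ∫⁻ x, ENNReal.ofReal x ∂h.derivStieltjes.measure = 1

/-- The Luxemburg norm `‖x‖_N = inf {t > 0 : ∑ i, N (|x i| / t) ≤ 1}` on `ℝⁿ`. -/
def luxemburgNorm (N : ℝ → ℝ) {n : ℕ} (x : Fin n → ℝ) : ℝ :=
  sInf {t : ℝ | 0 < t ∧ ∑ i, N (|x i| / t) ≤ 1}

/-- The function `M(s) = ∫_0^∞ N(s x) dP_{|X|}(x)`, where `P_{|X|}` is the law of `|X|`. -/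
def orliczMean {Ω : Type*} [MeasurableSpace Ω] (N : ℝ → ℝ) (μ : Measure Ω) (X : Ω → ℝ) (s : ℝ) : ℝ :=
  ∫ x in Ici 0, N (s * x) ∂(μ.map fun ω => |X ω|)

end

/-! Normalization is an asymptote condition. By layer cake, `∫ x dN'(x)` is the limit of `L t - N
t`, where `L = lim N'`, so a normalized `N` lies between `L t - 1` and `L t`. Averaging over `|X|`
replaces `L` by `L 𝔼|X|` and keeps the constant `1` when `X ≠ 0` a.s., so `M` is again normalized.

Put `w i = N (|a i * Y i| / t)`; then `∑ 𝔼 w i = ∑ M (|a i| / t)`. The upper estimate takes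
expectations in `‖z‖_N ≤ t (1 + ∑ N (|z i| / t))` with `t` admissible for `‖a‖_M`. For the lower
one, `t < ‖a‖_M` gives `∑ 𝔼 w i ≥ 1`. Both `min (∑ w) 1` and each `w i` are at most a multiple of
`‖·‖_N / t` (`mul_min_le_luxemburgNorm`, `mul_apply_le_two_mul_luxemburgNorm`), and stopping the
partial sums once they exceed `1` bounds the expectation from below
(`one_le_integral_of_iIndepFun`). -/

namespace IsOrlicz

variable {N : ℝ → ℝ}

/-! ### Elementary properties of Orlicz functions -/

theorem nonneg (h : IsOrlicz N) {x : ℝ} (hx : 0 ≤ x) : 0 ≤ N x := by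
  rcases hx.eq_or_lt with rfl | hx
  · exact h.map_zero.ge
  · exact (h.pos x hx).le

theorem map_mul_le (h : IsOrlicz N) {c x : ℝ} (hc : 0 ≤ c) (hc1 : c ≤ 1) (hx : 0 ≤ x) :
    N (c * x) ≤ c * N x := by
  have := h.convexOn.2 (mem_Ici.2 hx) (mem_Ici.2 le_rfl) hc (sub_nonneg.2 hc1) (by ring)
  simpa [h.map_zero] using this

theorem map_div_le (h : IsOrlicz N) {c x : ℝ} (hc : 1 ≤ c) (hx : 0 ≤ x) :
    N (x / c) ≤ N x / c := by
  have := h.map_mul_le (inv_nonneg.2 (zero_le_one.trans hc)) (inv_le_one_of_one_le₀ hc) hx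
  rwa [inv_mul_eq_div, inv_mul_eq_div] at this

theorem monotoneOn (h : IsOrlicz N) : MonotoneOn N (Ici 0) := by
  intro x hx y hy hxy
  rcases hxy.eq_or_lt with rfl | hlt
  · exact le_rfl
  have hx : 0 ≤ x := hx
  have hy0 : 0 < y := hx.trans_lt hlt
  have h1 := h.map_mul_le (div_nonneg hx hy0.le) ((div_le_one hy0).2 hxy) hy0.le
  rw [div_mul_cancel₀ _ hy0.ne'] at h1
  exact h1.trans (mul_le_of_le_one_left (h.nonneg hy0.le) ((div_le_one hy0).2 hxy))

/-- `N` is arbitrary on negative arguments, hence the clamping at `0`. -/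
theorem measurable_comp_max (h : IsOrlicz N) : Measurable fun x => N (max x 0) :=
  Monotone.measurable fun _ _ hxy =>
    h.monotoneOn (mem_Ici.2 (le_max_right _ _)) (mem_Ici.2 (le_max_right _ _)) (max_le_max_right 0 hxy)

theorem continuousOn (h : IsOrlicz N) : ContinuousOn N (Ici 0) := by
  intro x hx
  rcases (mem_Ici.1 hx).eq_or_lt with rfl | hx
  · exact continuousWithinAt_Ioi_iff_Ici.1 (h.hasDerivWithinAt le_rfl).continuousWithinAt
  · have hi : x ∈ interior (Ici (0 : ℝ)) := by simpa using hx
    exact (h.convexOn.continuousOn_interior.continuousAt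
      (isOpen_interior.mem_nhds hi)).continuousWithinAt

/-! ### The Stieltjes integral and the affine asymptote -/

theorem integral_rightDeriv (h : IsOrlicz N) {T : ℝ} (hT : 0 ≤ T) :
    IntervalIntegrable (rightDeriv N) volume 0 T ∧ ∫ x in (0 : ℝ)..T, rightDeriv N x = N T := by
  have hint : IntervalIntegrable (rightDeriv N) volume 0 T := by
    refine MonotoneOn.intervalIntegrable (h.monotoneOn_rightDeriv.mono ?_)
    rw [uIcc_of_le hT]
    exact Icc_subset_Ici_self
  refine ⟨hint, ?_⟩
  rw [intervalIntegral.integral_eq_sub_of_hasDeriv_right_of_le hT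
    (h.continuousOn.mono Icc_subset_Ici_self) (fun x hx => h.hasDerivWithinAt hx.1.le) hint,
    h.map_zero, sub_zero]

theorem lintegral_derivStieltjes (h : IsOrlicz N) :
    ∫⁻ x, ENNReal.ofReal x ∂h.derivStieltjes.measure =
      ∫⁻ t in Ioi 0, h.derivStieltjes.measure (Ioi t) := by
  have h1 := lintegral_eq_lintegral_meas_lt h.derivStieltjes.measure
    (f := fun x => max x 0) (Eventually.of_forall fun x => le_max_right x 0) (by fun_prop)
  simp only [ENNReal.ofReal_max, ENNReal.ofReal_zero, zero_le, max_eq_left] at h1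
  rw [h1]
  refine setLIntegral_congr_fun measurableSet_Ioi fun t ht => ?_
  congr 1
  ext a
  simp [(mem_Ioi.1 ht).le]

theorem rightDeriv_le_of_tendsto (h : IsOrlicz N) {L : ℝ}
    (hL : Tendsto (rightDeriv N) atTop (𝓝 L)) {x : ℝ} (hx : 0 ≤ x) : rightDeriv N x ≤ L :=
  ge_of_tendsto hL <| (eventually_ge_atTop x).mono fun _ hy =>
    h.monotoneOn_rightDeriv hx (hx.trans hy) hy

theorem tendsto_derivStieltjes (h : IsOrlicz N) {L : ℝ}
    (hL : Tendsto (rightDeriv N) atTop (𝓝 L)) : Tendsto h.derivStieltjes atTop (𝓝 L) := by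
  refine hL.congr' ?_
  filter_upwards [eventually_ge_atTop 0] with x hx
  simp [derivStieltjes, hx]

/-- If `N'` has the limit `L` at infinity, then `∫ x dN'(x)` is the limit of `L t - N t`. -/
theorem tendsto_ofReal_sub (h : IsOrlicz N) {L : ℝ} (hL : Tendsto (rightDeriv N) atTop (𝓝 L)) :
    Tendsto (fun t => ENNReal.ofReal (L * t - N t)) atTop
      (𝓝 (∫⁻ x, ENNReal.ofReal x ∂h.derivStieltjes.measure)) := by
  rw [h.lintegral_derivStieltjes]
  have hm : AEMeasurable (fun t => h.derivStieltjes.measure (Ioi t))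
      (volume.restrict (Ioi 0)) := by
    refine Measurable.aemeasurable (Antitone.measurable fun a b hab => ?_)
    exact measure_mono (Ioi_subset_Ioi hab)
  have key := (aecover_Iic (μ := volume.restrict (Ioi (0 : ℝ)))
    (tendsto_id (α := ℝ) (x := atTop))).lintegral_tendsto_of_countably_generated hm
  refine key.congr' ?_
  filter_upwards [eventually_ge_atTop 0] with T hT
  obtain ⟨hi, he⟩ := h.integral_rightDeriv hT
  rw [Measure.restrict_restrict measurableSet_Iic, inter_comm, id, Ioi_inter_Iic]
  -- The tail `dN'((t, ∞))` equals `L - N'(t)`.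
  have h1 : ∫ x in Ioc 0 T, (L - rightDeriv N x) = L * T - N T := by
    rw [← intervalIntegral.integral_of_le hT,
      intervalIntegral.integral_sub intervalIntegrable_const hi, he]
    simp [mul_comm]
  rw [← h1, ofReal_integral_eq_lintegral_ofReal]
  · refine setLIntegral_congr_fun measurableSet_Ioc fun t ht => ?_
    simp only [StieltjesFunction.measure_Ioi _ (h.tendsto_derivStieltjes hL)]
    simp [derivStieltjes, ht.1.le]
  · exact ((intervalIntegrable_const (c := L)).sub hi).1
  · exact (ae_restrict_mem measurableSet_Ioc).mono fun x hx =>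
      sub_nonneg.2 (h.rightDeriv_le_of_tendsto hL hx.1.le)

/-- `N'(t)` is squeezed between the slopes over `[0, t]` and `[t, 2t]`. -/
theorem tendsto_rightDeriv_of_tendsto_sub (h : IsOrlicz N) {L c : ℝ}
    (hc : Tendsto (fun t => L * t - N t) atTop (𝓝 c)) :
    Tendsto (rightDeriv N) atTop (𝓝 L) := by
  have hlow : Tendsto (fun t => L - (L * t - N t) * t⁻¹) atTop (𝓝 L) := by
    simpa using tendsto_const_nhds.sub (hc.mul tendsto_inv_atTop_zero)
  have hupp : Tendsto (fun t => L - ((L * (2 * t) - N (2 * t)) - (L * t - N t)) * t⁻¹) atTop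
      (𝓝 L) := by
    have h2 : Tendsto (fun t : ℝ => 2 * t) atTop atTop := tendsto_id.const_mul_atTop two_pos
    simpa using tendsto_const_nhds.sub (((hc.comp h2).sub hc).mul tendsto_inv_atTop_zero)
  refine tendsto_of_tendsto_of_tendsto_of_le_of_le' hlow hupp ?_ ?_
  · filter_upwards [eventually_gt_atTop 0] with t ht
    have := h.slope_le_rightDeriv le_rfl ht
    rw [slope_def_field, h.map_zero] at this
    refine le_trans (le_of_eq ?_) this
    field_simp
    ring
  · filter_upwards [eventually_gt_atTop 0] with t ht
    have := h.rightDeriv_le_slope ht.le (show t < 2 * t by linarith)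
    rw [slope_def_field] at this
    refine this.trans (le_of_eq ?_)
    have : 2 * t - t = t := by ring
    rw [this]
    field_simp
    ring

theorem isNormalizedOrlicz_of_tendsto (h : IsOrlicz N) {L : ℝ}
    (hc : Tendsto (fun t => L * t - N t) atTop (𝓝 1)) : IsNormalizedOrlicz N := by
  refine ⟨h, ?_⟩
  have h1 := h.tendsto_ofReal_sub (h.tendsto_rightDeriv_of_tendsto_sub hc)
  simpa using tendsto_nhds_unique h1 (ENNReal.tendsto_ofReal hc)

end IsOrlicz

/-- A normalized Orlicz function is asymptotic to an affine function `L t - 1`,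
and stays between this affine function and `L t`. -/
theorem IsNormalizedOrlicz.exists_asymptote {N : ℝ → ℝ} (hN : IsNormalizedOrlicz N) :
    ∃ L : ℝ, 0 < L ∧ (∀ t, 0 ≤ t → N t ≤ L * t) ∧ (∀ t, 0 ≤ t → L * t - 1 ≤ N t) ∧
      Tendsto (fun t => L * t - N t) atTop (𝓝 1) := by
  obtain ⟨h, h1⟩ := hN
  obtain ⟨L, hL⟩ : ∃ L, Tendsto (rightDeriv N) atTop (𝓝 L) := by
    -- If `N'` were unbounded, every tail would have infinite measure.
    rcases tendsto_atTop_of_monotone h.derivStieltjes.mono with ht | ⟨L, hL⟩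
    · rw [h.lintegral_derivStieltjes] at h1
      simp [StieltjesFunction.measure_Ioi_of_tendsto_atTop_atTop _ ht] at h1
    · refine ⟨L, hL.congr' ?_⟩
      filter_upwards [eventually_ge_atTop 0] with x hx
      simp [IsOrlicz.derivStieltjes, hx]
  -- As `N' ≤ L`, the gap `L t - N t` increases from `0` to its limit `1`, giving both bounds.
  have hmono : ∀ x y, 0 ≤ x → x ≤ y → L * x - N x ≤ L * y - N y := by
    intro x y hx hxy
    rcases hxy.eq_or_lt with rfl | hxy
    · exact le_rfl
    have hs := (h.slope_le_rightDeriv hx hxy).trans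
      (h.rightDeriv_le_of_tendsto hL (hx.trans hxy.le))
    rw [slope_def_field, div_le_iff₀ (sub_pos.2 hxy)] at hs
    linarith
  have hupper : ∀ t, 0 ≤ t → N t ≤ L * t := by
    intro t ht
    have := hmono 0 t le_rfl ht
    rw [h.map_zero] at this
    linarith
  have hlim : Tendsto (fun t => L * t - N t) atTop (𝓝 1) := by
    have h2 := h.tendsto_ofReal_sub hL
    rw [h1] at h2
    have h3 := (ENNReal.tendsto_toReal ENNReal.one_ne_top).comp h2
    rw [ENNReal.toReal_one] at h3
    refine h3.congr' ?_
    filter_upwards [eventually_ge_atTop 0] with t ht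
    exact ENNReal.toReal_ofReal (sub_nonneg.2 (hupper t ht))
  refine ⟨L, ?_, hupper, fun t ht => ?_, hlim⟩
  · have := hupper 1 zero_le_one
    linarith [h.pos 1 one_pos]
  · have := ge_of_tendsto hlim ((eventually_ge_atTop t).mono fun y hy => hmono t y ht hy)
    linarith

/-! ### Pointwise bounds for the Luxemburg norm -/

section Luxemburg

variable {N : ℝ → ℝ} {n : ℕ}

theorem luxemburgNorm_nonneg (N : ℝ → ℝ) (z : Fin n → ℝ) : 0 ≤ luxemburgNorm N z :=
  Real.sInf_nonneg fun _ ht => ht.1.le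

theorem luxemburgNorm_le_of_sum_le_one {z : Fin n → ℝ} {t : ℝ} (ht : 0 < t)
    (hs : ∑ i, N (|z i| / t) ≤ 1) : luxemburgNorm N z ≤ t :=
  csInf_le ⟨0, fun _ hr => hr.1.le⟩ ⟨ht, hs⟩

/-- Dividing the arguments by `1 + S` divides the values by at least as much, leaving `S / (1 + S)`.
-/
theorem IsOrlicz.sum_le_one_rescaled (h : IsOrlicz N) (z : Fin n → ℝ) {t : ℝ} (ht : 0 < t) :
    ∑ i, N (|z i| / (t * (1 + ∑ j, N (|z j| / t)))) ≤ 1 := by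
  have hz : ∀ i, 0 ≤ |z i| / t := fun i => div_nonneg (abs_nonneg _) ht.le
  have hS : 0 ≤ ∑ j, N (|z j| / t) := Finset.sum_nonneg fun j _ => h.nonneg (hz j)
  set S := ∑ j, N (|z j| / t) with hSdef
  calc ∑ i, N (|z i| / (t * (1 + S))) ≤ ∑ i, N (|z i| / t) / (1 + S) := by
        refine Finset.sum_le_sum fun i _ => ?_
        rw [← div_div]
        exact h.map_div_le (by linarith) (hz i)
    _ = S / (1 + S) := by rw [← Finset.sum_div]
    _ ≤ 1 := by rw [div_le_one (by linarith)]; linarith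

theorem IsOrlicz.luxemburgSet_nonempty (h : IsOrlicz N) (z : Fin n → ℝ) :
    {t : ℝ | 0 < t ∧ ∑ i, N (|z i| / t) ≤ 1}.Nonempty := by
  refine ⟨_, ?_, h.sum_le_one_rescaled z one_pos⟩
  have : 0 ≤ ∑ j, N (|z j| / 1) :=
    Finset.sum_nonneg fun j _ => h.nonneg (div_nonneg (abs_nonneg _) zero_le_one)
  positivity

theorem IsOrlicz.luxemburgNorm_le (h : IsOrlicz N) (z : Fin n → ℝ) {t : ℝ} (ht : 0 < t) :
    luxemburgNorm N z ≤ t * (1 + ∑ i, N (|z i| / t)) := by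
  refine luxemburgNorm_le_of_sum_le_one ?_ (h.sum_le_one_rescaled z ht)
  have : 0 ≤ ∑ j, N (|z j| / t) :=
    Finset.sum_nonneg fun j _ => h.nonneg (div_nonneg (abs_nonneg _) ht.le)
  positivity

theorem IsOrlicz.mul_min_le_luxemburgNorm (h : IsOrlicz N) (z : Fin n → ℝ) {t : ℝ}
    (ht : 0 < t) : t * min (∑ i, N (|z i| / t)) 1 ≤ luxemburgNorm N z := by
  refine le_csInf (h.luxemburgSet_nonempty z) fun r ⟨hr, hr1⟩ => ?_
  rcases le_total t r with htr | hrt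
  · exact (mul_le_of_le_one_right ht.le (min_le_right _ _)).trans htr
  have hle : ∑ i, N (|z i| / t) ≤ r / t := by
    calc ∑ i, N (|z i| / t) ≤ ∑ i, r / t * N (|z i| / r) := by
          refine Finset.sum_le_sum fun i _ => ?_
          have := h.map_mul_le (div_pos hr ht).le ((div_le_one ht).2 hrt)
            (div_nonneg (abs_nonneg (z i)) hr.le)
          rwa [show r / t * (|z i| / r) = |z i| / t by field_simp] at this
      _ = r / t * ∑ i, N (|z i| / r) := by rw [Finset.mul_sum]
      _ ≤ r / t := mul_le_of_le_one_right (div_pos hr ht).le hr1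
  calc t * min (∑ i, N (|z i| / t)) 1 ≤ t * (r / t) := by
        gcongr
        exact (min_le_left _ _).trans hle
    _ = r := by field_simp

/-- For admissible `r`, `L |z i| / r - 1 ≤ N (|z i| / r) ≤ 1`, so `t N (|z i| / t) ≤ L |z i| ≤ 2 r`.
-/
theorem IsOrlicz.mul_apply_le_two_mul_luxemburgNorm (h : IsOrlicz N) {L : ℝ}
    (hu : ∀ t, 0 ≤ t → N t ≤ L * t) (hl : ∀ t, 0 ≤ t → L * t - 1 ≤ N t) (z : Fin n → ℝ)
    {t : ℝ} (ht : 0 < t) (i : Fin n) : t * N (|z i| / t) ≤ 2 * luxemburgNorm N z := by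
  rw [← div_le_iff₀' two_pos]
  refine le_csInf (h.luxemburgSet_nonempty z) fun r ⟨hr, hr1⟩ => ?_
  have h1 : N (|z i| / r) ≤ 1 := (Finset.single_le_sum
    (fun j _ => h.nonneg (div_nonneg (abs_nonneg (z j)) hr.le)) (Finset.mem_univ i)).trans hr1
  have h2 := hl (|z i| / r) (div_nonneg (abs_nonneg _) hr.le)
  have h3 : L * (|z i| / r) ≤ 2 := by linarith
  rw [← mul_div_assoc, div_le_iff₀ hr] at h3
  have h4 : t * N (|z i| / t) ≤ t * (L * (|z i| / t)) := by
    gcongr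
    exact hu _ (div_nonneg (abs_nonneg _) ht.le)
  rw [show t * (L * (|z i| / t)) = L * |z i| by field_simp] at h4
  linarith

/-- Admissible scales are closed upwards, so rational ones suffice. -/
theorem IsOrlicz.measurable_luxemburgNorm (h : IsOrlicz N) :
    Measurable fun z : Fin n → ℝ => luxemburgNorm N z := by
  refine measurable_of_Iio fun r => ?_
  have : (fun z : Fin n → ℝ => luxemburgNorm N z) ⁻¹' Iio r =
      ⋃ q : ℚ, {z | 0 < (q : ℝ) ∧ (q : ℝ) < r ∧ ∑ i, N (max (|z i| / q) 0) ≤ 1} := by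
    ext z
    simp only [mem_preimage, mem_Iio, mem_iUnion, mem_ofPred_eq]
    constructor
    · intro hz
      obtain ⟨t, ⟨ht, ht1⟩, htr⟩ := exists_lt_of_csInf_lt (h.luxemburgSet_nonempty z) hz
      obtain ⟨q, hq, hqr⟩ := exists_rat_btwn htr
      refine ⟨q, ht.trans hq, hqr, le_trans (Finset.sum_le_sum fun i _ => ?_) ht1⟩
      rw [max_eq_left (div_nonneg (abs_nonneg _) (ht.trans hq).le)]
      refine h.monotoneOn (mem_Ici.2 (div_nonneg (abs_nonneg _) (ht.trans hq).le))
        (mem_Ici.2 (div_nonneg (abs_nonneg _) ht.le)) ?_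
      gcongr
    · rintro ⟨q, hq, hqr, hs⟩
      refine (luxemburgNorm_le_of_sum_le_one hq ?_).trans_lt hqr
      simpa only [max_eq_left (div_nonneg (abs_nonneg (z _)) hq.le)] using hs
  rw [this]
  refine MeasurableSet.iUnion fun q => ?_
  have hsum : Measurable fun z : Fin n → ℝ => ∑ i, N (max (|z i| / q) 0) :=
    Finset.measurable_fun_sum _ fun i _ =>
      h.measurable_comp_max.comp (g := fun x => N (max x 0)) (by fun_prop)
  exact (MeasurableSet.const _).inter
    ((MeasurableSet.const _).inter (measurableSet_le hsum measurable_const))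

end Luxemburg

/-! ### The averaged function `M` -/

section Mean

variable {Ω : Type*} [MeasurableSpace Ω] {μ : Measure Ω} {X : Ω → ℝ} {N : ℝ → ℝ}

theorem IsOrlicz.aemeasurable_comp_mul_abs (h : IsOrlicz N) (hX : AEMeasurable X μ) {s : ℝ}
    (hs : 0 ≤ s) : AEMeasurable (fun ω => N (s * |X ω|)) μ := by
  have h1 : (fun ω => N (s * |X ω|)) = fun ω => N (max (s * |X ω|) 0) := by
    ext ω
    rw [max_eq_left (mul_nonneg hs (abs_nonneg _))]
  rw [h1]
  exact h.measurable_comp_max.comp_aemeasurable (by fun_prop)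

theorem IsOrlicz.integrable_comp_mul_abs (h : IsOrlicz N) (hX : Integrable X μ) {L : ℝ}
    (hu : ∀ t, 0 ≤ t → N t ≤ L * t) {s : ℝ} (hs : 0 ≤ s) :
    Integrable (fun ω => N (s * |X ω|)) μ := by
  refine (hX.abs.const_mul (L * s)).mono'
    (h.aemeasurable_comp_mul_abs hX.aemeasurable hs).aestronglyMeasurable ?_
  refine Eventually.of_forall fun ω => ?_
  have h0 := mul_nonneg hs (abs_nonneg (X ω))
  rw [Real.norm_of_nonneg (h.nonneg h0), mul_assoc]
  exact hu _ h0

theorem restrict_Ici_map_abs (hX : AEMeasurable X μ) :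
    (μ.map fun ω => |X ω|).restrict (Ici 0) = μ.map fun ω => |X ω| := by
  refine Measure.restrict_eq_self_of_ae_mem ?_
  exact (ae_map_iff (p := fun x => x ∈ Ici 0) (by fun_prop) measurableSet_Ici).2
    (Eventually.of_forall fun ω => abs_nonneg (X ω))

theorem IsOrlicz.integrableOn_map_abs_iff (h : IsOrlicz N) (hX : AEMeasurable X μ) {s : ℝ}
    (hs : 0 ≤ s) : IntegrableOn (fun x => N (s * x)) (Ici 0) (μ.map fun ω => |X ω|) ↔
      Integrable (fun ω => N (s * |X ω|)) μ := by
  have hg : Measurable fun x : ℝ => N (max (s * x) 0) :=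
    h.measurable_comp_max.comp (by fun_prop)
  rw [integrableOn_congr_fun (g := fun x => N (max (s * x) 0)) (fun x hx => by
      simp only [max_eq_left (mul_nonneg hs (mem_Ici.1 hx))]) measurableSet_Ici, IntegrableOn,
    restrict_Ici_map_abs hX, integrable_map_measure hg.aestronglyMeasurable (by fun_prop)]
  simp only [Function.comp_def, max_eq_left (mul_nonneg hs (abs_nonneg (X _)))]

theorem IsOrlicz.orliczMean_eq_integral (h : IsOrlicz N) (hX : AEMeasurable X μ) {s : ℝ}
    (hs : 0 ≤ s) : orliczMean N μ X s = ∫ ω, N (s * |X ω|) ∂μ := by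
  have hg : Measurable fun x : ℝ => N (max (s * x) 0) :=
    h.measurable_comp_max.comp (by fun_prop)
  rw [orliczMean, setIntegral_congr_fun (g := fun x => N (max (s * x) 0)) measurableSet_Ici
    (fun x hx => by simp only [max_eq_left (mul_nonneg hs (mem_Ici.1 hx))]),
    restrict_Ici_map_abs hX, integral_map (by fun_prop) hg.aestronglyMeasurable]
  simp only [max_eq_left (mul_nonneg hs (abs_nonneg (X _)))]

theorem IsOrlicz.isOrlicz_orliczMean (h : IsOrlicz N) (hX : Integrable X μ) {L : ℝ}
    (hu : ∀ t, 0 ≤ t → N t ≤ L * t) (h0 : ¬ X =ᵐ[μ] 0) : IsOrlicz (orliczMean N μ X) where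
  convexOn := by
    refine ⟨convex_Ici 0, fun x hx y hy a b ha hb hab => ?_⟩
    have hx : 0 ≤ x := hx
    have hy : 0 ≤ y := hy
    simp only [smul_eq_mul]
    rw [h.orliczMean_eq_integral hX.aemeasurable hx, h.orliczMean_eq_integral hX.aemeasurable hy,
      h.orliczMean_eq_integral hX.aemeasurable (by positivity), ← integral_const_mul,
      ← integral_const_mul, ← integral_add ((h.integrable_comp_mul_abs hX hu hx).const_mul a)
        ((h.integrable_comp_mul_abs hX hu hy).const_mul b)]
    refine integral_mono (h.integrable_comp_mul_abs hX hu (by positivity))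
      (((h.integrable_comp_mul_abs hX hu hx).const_mul a).add
        ((h.integrable_comp_mul_abs hX hu hy).const_mul b)) fun ω => ?_
    have := h.convexOn.2 (mem_Ici.2 (mul_nonneg hx (abs_nonneg (X ω))))
      (mem_Ici.2 (mul_nonneg hy (abs_nonneg (X ω)))) ha hb hab
    simp only [smul_eq_mul] at this
    refine le_trans (le_of_eq ?_) this
    congr 1
    ring
  map_zero := by
    rw [h.orliczMean_eq_integral hX.aemeasurable le_rfl]
    simp [h.map_zero]
  pos t ht := by
    rw [h.orliczMean_eq_integral hX.aemeasurable ht.le]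
    have hnn : ∀ ω, 0 ≤ N (t * |X ω|) := fun ω => h.nonneg (mul_nonneg ht.le (abs_nonneg _))
    refine (integral_nonneg hnn).lt_of_ne fun heq => h0 ?_
    have := (integral_eq_zero_iff_of_nonneg hnn (h.integrable_comp_mul_abs hX hu ht.le)).1 heq.symm
    filter_upwards [this] with ω hω
    by_contra hne
    exact (h.pos _ (mul_pos ht (abs_pos.2 hne))).ne' hω

theorem IsNormalizedOrlicz.isNormalizedOrlicz_orliczMean [IsProbabilityMeasure μ]
    (hN : IsNormalizedOrlicz N) (hX : Integrable X μ) (h0 : ∀ᵐ ω ∂μ, X ω ≠ 0) :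
    IsNormalizedOrlicz (orliczMean N μ X) := by
  obtain ⟨L, -, hu, hl, hlim⟩ := hN.exists_asymptote
  obtain ⟨h, -⟩ := hN
  have hne : ¬ X =ᵐ[μ] 0 := fun hz => by
    obtain ⟨ω, h1, h2⟩ := (h0.and hz).exists
    exact h1 h2
  refine (h.isOrlicz_orliczMean hX hu hne).isNormalizedOrlicz_of_tendsto
    (L := L * ∫ ω, |X ω| ∂μ) ?_
  -- The integrand lies in `[0, 1]` and tends to `1` wherever `X ω ≠ 0`.
  have hD : Tendsto (fun t => ∫ ω, (L * (t * |X ω|) - N (t * |X ω|)) ∂μ) atTop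
      (𝓝 (∫ _, (1 : ℝ) ∂μ)) := by
    refine tendsto_integral_filter_of_dominated_convergence (fun _ => 1) ?_ ?_
      (integrable_const 1) ?_
    · filter_upwards [eventually_ge_atTop 0] with t ht
      exact (((hX.abs.const_mul t).const_mul L).sub
        (h.integrable_comp_mul_abs hX hu ht)).aestronglyMeasurable
    · filter_upwards [eventually_ge_atTop 0] with t ht
      refine Eventually.of_forall fun ω => ?_
      have hz := mul_nonneg ht (abs_nonneg (X ω))
      rw [Real.norm_of_nonneg (sub_nonneg.2 (hu _ hz))]
      linarith [hl _ hz]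
    · filter_upwards [h0] with ω hω
      exact hlim.comp (tendsto_id.atTop_mul_const (abs_pos.2 hω))
  simp only [integral_const, probReal_univ, smul_eq_mul, mul_one] at hD
  refine hD.congr' ?_
  filter_upwards [eventually_ge_atTop 0] with t ht
  rw [integral_sub ((hX.abs.const_mul t).const_mul L) (h.integrable_comp_mul_abs hX hu ht),
    integral_const_mul, integral_const_mul, h.orliczMean_eq_integral hX.aemeasurable ht]
  ring

end Mean

/-! ### Stopped sums of independent variables -/

section Independent

variable {Ω : Type*} [MeasurableSpace Ω] {μ : Measure Ω} {n : ℕ}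

/-- The terms whose preceding partial sum is at most `1` add up to at most
`min (∑ w) 1` plus one more term. -/
theorem sum_ite_partialSum_le {w : Fin n → ℝ} (hw : ∀ i, 0 ≤ w i) {m : ℝ} (hm : 0 ≤ m)
    (hwm : ∀ i, w i ≤ m) :
    ∑ k, w k * (if ∑ j ∈ Finset.Iio k, w j ≤ 1 then 1 else 0) ≤ min (∑ i, w i) 1 + m := by
  have hsum : ∑ k, w k * (if ∑ j ∈ Finset.Iio k, w j ≤ 1 then (1 : ℝ) else 0) =
      ∑ k with ∑ j ∈ Finset.Iio k, w j ≤ 1, w k := by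
    simp only [mul_ite, mul_one, mul_zero, Finset.sum_filter]
  rw [hsum]
  set A : Finset (Fin n) := {k | ∑ j ∈ Finset.Iio k, w j ≤ 1} with hA
  rcases A.eq_empty_or_nonempty with hE | hne
  · rw [hE, Finset.sum_empty]
    exact add_nonneg (le_min (Finset.sum_nonneg fun i _ => hw i) zero_le_one) hm
  -- `k` is the last index counted; only `w k` can push the sum past `1`.
  obtain ⟨k, hk, hmax⟩ := A.exists_max_image id hne
  have hk1 : ∑ j ∈ Finset.Iio k, w j ≤ 1 := by simpa [hA] using hk
  calc ∑ j ∈ A, w j ≤ ∑ j ∈ Finset.Iic k, w j :=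
        Finset.sum_le_sum_of_subset_of_nonneg (fun j hj => Finset.mem_Iic.2 (hmax j hj))
          fun j _ _ => hw j
    _ = ∑ j ∈ Finset.Iio k, w j + w k := by
        rw [← Finset.Iio_insert, Finset.sum_insert (by simp), add_comm]
    _ ≤ min (∑ i, w i) 1 + m := by
        refine add_le_add (le_min ?_ hk1) (hwm k)
        exact Finset.sum_le_sum_of_subset_of_nonneg (Finset.subset_univ _) fun j _ _ => hw j

/-- If independent nonnegative variables have expectations adding up to at least `1`, then a
variable dominating each of them and the truncated sum has expectation bounded below. -/
theorem one_le_integral_of_iIndepFun [IsProbabilityMeasure μ] {w : Fin n → Ω → ℝ}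
    (hw : ∀ i ω, 0 ≤ w i ω) (hint : ∀ i, Integrable (w i) μ) (hind : iIndepFun w μ)
    (h1 : 1 ≤ ∑ i, ∫ ω, w i ω ∂μ) {F G : Ω → ℝ} (hF : Integrable F μ) (hG : Integrable G μ)
    (hFw : ∀ ω, min (∑ i, w i ω) 1 ≤ F ω) (hG0 : ∀ ω, 0 ≤ G ω) (hGw : ∀ i ω, w i ω ≤ G ω) :
    1 ≤ 2 * ∫ ω, F ω ∂μ + ∫ ω, G ω ∂μ := by
  have hmeas : ∀ i, AEMeasurable (w i) μ := fun i => (hint i).aemeasurable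
  have hφ : Measurable fun x : ℝ => if x ≤ 1 then (1 : ℝ) else 0 :=
    Measurable.ite measurableSet_Iic measurable_const measurable_const
  have hφint : ∀ s : Finset (Fin n),
      Integrable (fun ω => if ∑ j ∈ s, w j ω ≤ 1 then (1 : ℝ) else 0) μ := fun s =>
    Integrable.of_bound (hφ.comp_aemeasurable
      (Finset.aemeasurable_fun_sum s fun i _ => hmeas i)).aestronglyMeasurable 1
      (Eventually.of_forall fun ω => by split_ifs <;> simp)
  set p : ℝ := ∫ ω, (if ∑ j, w j ω ≤ 1 then (1 : ℝ) else 0) ∂μ with hp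
  have hp0 : 0 ≤ p := integral_nonneg fun ω => by
    dsimp only
    split_ifs <;> simp
  have hindk : ∀ k, IndepFun (w k)
      (fun ω => if ∑ j ∈ Finset.Iio k, w j ω ≤ 1 then (1 : ℝ) else 0) μ := by
    intro k
    have := (hind.indepFun_finsetSum_of_notMem₀ hmeas (s := Finset.Iio k) (i := k)
      (by simp)).symm.comp measurable_id hφ
    simpa [Function.comp_def, Finset.sum_apply] using this
  have hkint : ∀ k, Integrable
      (fun ω => w k ω * if ∑ j ∈ Finset.Iio k, w j ω ≤ 1 then (1 : ℝ) else 0) μ := fun k =>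
    (hindk k).integrable_mul (hint k) (hφint _)
  -- The indicator depends only on earlier indices, and it dominates the indicator of a full sum at
  -- most `1`, whose mean is `p`.
  have hterm : ∀ k, (∫ ω, w k ω ∂μ) * p ≤
      ∫ ω, w k ω * (if ∑ j ∈ Finset.Iio k, w j ω ≤ 1 then (1 : ℝ) else 0) ∂μ := by
    intro k
    rw [(hindk k).integral_fun_mul_eq_mul_integral (hint k).1 (hφint _).1]
    refine mul_le_mul_of_nonneg_left (integral_mono (hφint _) (hφint _) fun ω => ?_)
      (integral_nonneg (hw k))
    have : ∑ j ∈ Finset.Iio k, w j ω ≤ ∑ j, w j ω :=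
      Finset.sum_le_sum_of_subset_of_nonneg (Finset.subset_univ _) fun j _ _ => hw j ω
    dsimp only
    split_ifs <;> linarith
  have hupper : p ≤ ∫ ω, F ω ∂μ + ∫ ω, G ω ∂μ := by
    calc p ≤ (∑ k, ∫ ω, w k ω ∂μ) * p := le_mul_of_one_le_left hp0 h1
      _ ≤ ∑ k, ∫ ω, w k ω *
          (if ∑ j ∈ Finset.Iio k, w j ω ≤ 1 then (1 : ℝ) else 0) ∂μ := by
        rw [Finset.sum_mul]
        exact Finset.sum_le_sum fun k _ => hterm k
      _ = ∫ ω, ∑ k, w k ω *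
          (if ∑ j ∈ Finset.Iio k, w j ω ≤ 1 then (1 : ℝ) else 0) ∂μ :=
        (integral_finsetSum _ fun k _ => hkint k).symm
      _ ≤ ∫ ω, (F ω + G ω) ∂μ := by
        refine integral_mono (integrable_finsetSum _ fun k _ => hkint k) (hF.add hG) fun ω => ?_
        exact (sum_ite_partialSum_le (fun i => hw i ω) (hG0 ω) fun i => hGw i ω).trans
          (add_le_add_left (hFw ω) _)
      _ = _ := integral_add hF hG
  -- Off the event defining `p`, `F ≥ 1`. Adding the two bounds eliminates `p`.
  have hlower : 1 - p ≤ ∫ ω, F ω ∂μ := by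
    have : (1 : ℝ) - p = ∫ ω, (1 - if ∑ j, w j ω ≤ 1 then (1 : ℝ) else 0) ∂μ := by
      rw [integral_sub (integrable_const 1) (hφint _)]
      simp [hp]
    rw [this]
    refine integral_mono ((integrable_const 1).sub (hφint _)) hF fun ω => ?_
    refine le_trans ?_ (hFw ω)
    have := Finset.sum_nonneg fun j (_ : j ∈ Finset.univ) => hw j ω
    refine le_min ?_ ?_ <;> split_ifs <;> linarith
  linarith

end Independent

/-! ### Expectation of the Luxemburg norm -/

section Expectation

variable {Ω Ω' : Type*} [MeasurableSpace Ω] [MeasurableSpace Ω'] {μ : Measure Ω}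
  {μ' : Measure Ω'} {X : Ω → ℝ} {N : ℝ → ℝ} {n : ℕ} {Y : Fin n → Ω' → ℝ}

theorem abs_mul_div (a y t : ℝ) : |a * y| / t = |a| / t * |y| := by
  rw [abs_mul, div_mul_eq_mul_div]

theorem IsOrlicz.integral_comp_of_identDistrib (h : IsOrlicz N) {Z : Ω' → ℝ}
    (hid : IdentDistrib Z X μ' μ) (a : ℝ) {t : ℝ} (ht : 0 < t) :
    ∫ ω, N (|a * Z ω| / t) ∂μ' = orliczMean N μ X (|a| / t) := by
  have hs : 0 ≤ |a| / t := div_nonneg (abs_nonneg _) ht.le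
  have hlaw := (hid.comp (u := fun x => |x|) (by fun_prop)).map_eq
  simp only [Function.comp_def] at hlaw
  simp only [abs_mul_div]
  rw [← h.orliczMean_eq_integral hid.aemeasurable_fst hs, orliczMean, orliczMean, hlaw]

theorem IsOrlicz.integrable_luxemburgNorm [IsProbabilityMeasure μ'] (h : IsOrlicz N) {L : ℝ}
    (hu : ∀ t, 0 ≤ t → N t ≤ L * t) (hY : ∀ i, Integrable (Y i) μ') (a : Fin n → ℝ) :
    Integrable (fun ω => luxemburgNorm N fun i => a i * Y i ω) μ' ∧ ∀ t, 0 < t →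
      ∫ ω, luxemburgNorm N (fun i => a i * Y i ω) ∂μ' ≤
        t * (1 + ∑ i, ∫ ω, N (|a i * Y i ω| / t) ∂μ') := by
  have hint : ∀ t, 0 < t → ∀ i, Integrable (fun ω => N (|a i * Y i ω| / t)) μ' := by
    intro t ht i
    simp only [abs_mul_div]
    exact h.integrable_comp_mul_abs (hY i) hu (div_nonneg (abs_nonneg _) ht.le)
  have hdom : ∀ t, 0 < t → Integrable (fun ω => t * (1 + ∑ i, N (|a i * Y i ω| / t))) μ' :=
    fun t ht =>
      ((integrable_const 1).add (integrable_finsetSum _ fun i _ => hint t ht i)).const_mul t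
  have hmain : Integrable (fun ω => luxemburgNorm N fun i => a i * Y i ω) μ' := by
    refine (hdom 1 one_pos).mono' ?_ (Eventually.of_forall fun ω => ?_)
    · refine (h.measurable_luxemburgNorm.comp_aemeasurable ?_).aestronglyMeasurable
      exact aemeasurable_pi_lambda _ fun i => (hY i).aemeasurable.const_mul (a i)
    · rw [Real.norm_of_nonneg (luxemburgNorm_nonneg _ _)]
      exact h.luxemburgNorm_le _ one_pos
  refine ⟨hmain, fun t ht => ?_⟩
  refine (integral_mono hmain (hdom t ht) fun ω => h.luxemburgNorm_le _ ht).trans_eq ?_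
  rw [integral_const_mul, integral_add (integrable_const 1)
    (integrable_finsetSum _ fun i _ => hint t ht i), integral_finsetSum _ fun i _ => hint t ht i]
  simp

theorem IsNormalizedOrlicz.le_integral_luxemburgNorm [IsProbabilityMeasure μ']
    (hN : IsNormalizedOrlicz N) (hY : ∀ i, Integrable (Y i) μ') (hind : iIndepFun Y μ')
    (a : Fin n → ℝ) {t : ℝ} (ht : 0 < t) (h1 : 1 ≤ ∑ i, ∫ ω, N (|a i * Y i ω| / t) ∂μ') :
    t ≤ 4 * ∫ ω, luxemburgNorm N (fun i => a i * Y i ω) ∂μ' := by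
  obtain ⟨L, -, hu, hl, -⟩ := hN.exists_asymptote
  obtain ⟨h, -⟩ := hN
  have hf := (h.integrable_luxemburgNorm hu hY a).1
  have hnn : ∀ i ω, 0 ≤ |a i * Y i ω| / t := fun i ω => div_nonneg (abs_nonneg _) ht.le
  -- Here `2 F + G` is `4 ‖·‖_N / t`, the source of the constant `4`.
  have key := one_le_integral_of_iIndepFun (μ := μ') (w := fun i ω => N (|a i * Y i ω| / t))
    (F := fun ω => luxemburgNorm N (fun i => a i * Y i ω) / t)
    (G := fun ω => 2 * luxemburgNorm N (fun i => a i * Y i ω) / t)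
    (fun i ω => h.nonneg (hnn i ω))
    (fun i => by
      simp only [abs_mul_div]
      exact h.integrable_comp_mul_abs (hY i) hu (div_nonneg (abs_nonneg _) ht.le))
    (by
      have hg : ∀ i, Measurable fun y : ℝ => N (max (|a i * y| / t) 0) := fun i =>
        h.measurable_comp_max.comp (by fun_prop)
      have := hind.comp _ hg
      simpa only [Function.comp_def, max_eq_left (hnn _ _)] using this)
    h1 (hf.div_const t) ((hf.const_mul 2).div_const t)
    (fun ω => by
      rw [le_div_iff₀' ht]
      exact h.mul_min_le_luxemburgNorm _ ht)
    (fun ω => div_nonneg (mul_nonneg two_pos.le (luxemburgNorm_nonneg _ _)) ht.le)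
    (fun i ω => by
      rw [le_div_iff₀' ht]
      exact h.mul_apply_le_two_mul_luxemburgNorm hu hl (fun i => a i * Y i ω) ht i)
  rw [integral_div, integral_div, integral_const_mul, ← mul_div_assoc, ← add_div,
    le_div_iff₀ ht] at key
  linarith

end Expectation

theorem theorem6p1 :
    ∃ c₁ c₂ : ℝ, 0 < c₁ ∧ 0 < c₂ ∧
      ∀ N : ℝ → ℝ, IsNormalizedOrlicz N →
        (∀ᵐ x ∂(volume.restrict (Ioi (0 : ℝ))),
          DifferentiableAt ℝ N x ∧ DifferentiableAt ℝ (rightDeriv N) x) →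
        IntegrableOn (deriv (rightDeriv N)) (Ioi 0) volume →
        rightDeriv N 0 = 0 →
      ∀ (Ω : Type*) [MeasurableSpace Ω] (μ : Measure Ω) [IsProbabilityMeasure μ] (X : Ω → ℝ),
        Integrable X μ →
        -- the integral defining `M` converges
        (∀ s : ℝ, 0 ≤ s →
          IntegrableOn (fun x => N (s * x)) (Ici 0) (μ.map fun ω => |X ω|)) ∧
        (¬ X =ᵐ[μ] 0 → IsOrlicz (orliczMean N μ X)) ∧
        ((∀ᵐ ω ∂μ, X ω ≠ 0) → IsNormalizedOrlicz (orliczMean N μ X)) ∧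
        ∀ (n : ℕ) (Ω' : Type*) [MeasurableSpace Ω'] (μ' : Measure Ω') [IsProbabilityMeasure μ']
          (Y : Fin n → Ω' → ℝ),
          iIndepFun Y μ' → (∀ i, IdentDistrib (Y i) X μ' μ) →
          ∀ a : Fin n → ℝ,
            Integrable (fun ω => luxemburgNorm N (fun i => a i * Y i ω)) μ' ∧
            c₁ * luxemburgNorm (orliczMean N μ X) a ≤
              ∫ ω, luxemburgNorm N (fun i => a i * Y i ω) ∂μ' ∧
            ∫ ω, luxemburgNorm N (fun i => a i * Y i ω) ∂μ' ≤
              c₂ * luxemburgNorm (orliczMean N μ X) a := by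
  refine ⟨1 / 4, 2, by norm_num, by norm_num, ?_⟩
  intro N hN _ _ _ Ω _ μ _ X hX
  obtain ⟨L, -, hu, -, -⟩ := hN.exists_asymptote
  have h : IsOrlicz N := hN.1
  refine ⟨fun s hs => (h.integrableOn_map_abs_iff hX.aemeasurable hs).2
      (h.integrable_comp_mul_abs hX hu hs), h.isOrlicz_orliczMean hX hu,
    hN.isNormalizedOrlicz_orliczMean hX, ?_⟩
  intro n Ω' _ μ' _ Y hind hid a
  have hY : ∀ i, Integrable (Y i) μ' := fun i => (hid i).integrable_iff.2 hX
  obtain ⟨hint, hupper⟩ := h.integrable_luxemburgNorm hu hY a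
  have hsum : ∀ t, 0 < t → ∑ i, ∫ ω, N (|a i * Y i ω| / t) ∂μ' =
      ∑ i, orliczMean N μ X (|a i| / t) := fun t ht =>
    Finset.sum_congr rfl fun i _ => h.integral_comp_of_identDistrib (hid i) (a i) ht
  have hE : 0 ≤ ∫ ω, luxemburgNorm N (fun i => a i * Y i ω) ∂μ' :=
    integral_nonneg fun _ => luxemburgNorm_nonneg _ _
  refine ⟨hint, ?_, ?_⟩
  · by_contra! hlt
    -- Such a `t` is inadmissible for `‖a‖_M`, so the means sum to more than `1`.
    obtain ⟨t, ht1, ht2⟩ := exists_between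
      (show 4 * ∫ ω, luxemburgNorm N (fun i => a i * Y i ω) ∂μ' <
        luxemburgNorm (orliczMean N μ X) a by linarith)
    have ht : 0 < t := (mul_nonneg (by norm_num) hE).trans_lt ht1
    refine ht1.not_ge (hN.le_integral_luxemburgNorm hY hind a ht ?_)
    rw [hsum t ht]
    by_contra! hs
    exact ht2.not_ge (luxemburgNorm_le_of_sum_le_one ht hs.le)
  -- If `X = 0` a.s., then `M` vanishes on `[0, ∞)` and is not Orlicz, so this case is separate.
  · have hne : {t : ℝ | 0 < t ∧ ∑ i, orliczMean N μ X (|a i| / t) ≤ 1}.Nonempty := by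
      by_cases h0 : X =ᵐ[μ] 0
      · refine ⟨1, one_pos, ?_⟩
        have hz : ∀ s, 0 ≤ s → orliczMean N μ X s = 0 := by
          intro s hs
          rw [h.orliczMean_eq_integral hX.aemeasurable hs]
          refine integral_eq_zero_of_ae ?_
          filter_upwards [h0] with ω hω
          simp [hω, h.map_zero]
        rw [Finset.sum_eq_zero fun i _ => hz _ (div_nonneg (abs_nonneg _) zero_le_one)]
        exact zero_le_one
      · exact (h.isOrlicz_orliczMean hX hu h0).luxemburgSet_nonempty a
    rw [← div_le_iff₀' two_pos]
    refine le_csInf hne fun t ⟨ht, ht1⟩ => ?_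
    have h1 := hupper t ht
    rw [hsum t ht] at h1
    have h2 : t * (1 + ∑ i, orliczMean N μ X (|a i| / t)) ≤ t * (1 + 1) := by gcongr
    linarith
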